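/- For a set $T\subseteq\mathbb{R}^p$ let $w(T)=\mathbb{E}\big[\sup_{v\in T}\langle v,g\rangle\big]$ be its Gaussian width, where $g$ is a standard Gaussian random vector in $\mathbb{R}^p$ (the supremum over the empty set is read as $0$). For a real random variable $x$ let $\|x\|_{\psi_2}=\sup_{q\ge 1} q^{-1/2}\,(\mathbb{E}|x|^q)^{1/q}$, for a random vector $x$ let $\|x\|_{\psi_2}=\sup_{\|a\|_2=1}\|\langle x,a\rangle\|_{\psi_2}$, and let $\kappa_0=\|g\|_{\psi_2}$. For $A\subseteq\mathbb{R}^p$ let $\mathrm{cone}(A)=\{ta : t\ge 0,\ a\in A\}$. There is an absolute constant $C>0$ such that the following holds for all $m$ and $p$. Let $X$ be a random $m\times p$ matrix with square-integrable entries, and for $u\in\mathbb{S}^{m-1}$ put $\Gamma_u=\mathbb{E}[X^T u u^T X]$. Suppose that $\mu_{\min}>0$ and $\mu_{\max}$ are real numbers such that all eigenvalues of $\Gamma_u$ lie in $[\mu_{\min},\mu_{\max}]$ for every $u\in\mathbb{S}^{m-1}$. Fix $u\in\mathbb{S}^{m-1}$ and $\mathcal{A}\subseteq\mathbb{S}^{p-1}$,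 and let $$\mathcal{A}_{\Gamma_u}=\big\{v\in\mathbb{S}^{p-1} : \Gamma_u^{-1/2}v\in\mathrm{cone}(\mathcal{A})\big\}.$$ Then $$w(\mathcal{A}_{\Gamma_u})\le C\,\kappa_0\sqrt{\mu_{\max}/\mu_{\min}}\;\big(w(\mathcal{A})+3\big).$$ -/

import Mathlib

open MeasureTheory ProbabilityTheory
open scoped ENNReal Matrix MatrixOrder

noncomputable section

/-- Gaussian width `w(T) = E[sup_{v ∈ T} ⟨v, g⟩]` with `g` a standard Gaussian vector in `ℝ^p`. -/
def gaussianWidth {p : ℕ} (T : Set (EuclideanSpace ℝ (Fin p))) : ℝ :=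
  ∫ g, (⨆ v : T, inner ℝ (v : EuclideanSpace ℝ (Fin p)) g) ∂(stdGaussian (EuclideanSpace ℝ (Fin p)))

/-- The `ψ₂`-norm of a real random variable: `sup_{q ≥ 1} q^{-1/2} (E|x|^q)^{1/q}`. -/
def psi2Norm {Ω : Type*} [MeasurableSpace Ω] (P : Measure Ω) (x : Ω → ℝ) : ℝ≥0∞ :=
  ⨆ q : ℝ, ⨆ _ : 1 ≤ q, eLpNorm x (ENNReal.ofReal q) P / ENNReal.ofReal (√q)

/-- The `ψ₂`-norm of a random vector: the supremum over unit vectors `a` of the `ψ₂`-norm of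
`⟨x, a⟩`. -/
def psi2NormVec {p : ℕ} {Ω : Type*} [MeasurableSpace Ω] (P : Measure Ω)
    (x : Ω → EuclideanSpace ℝ (Fin p)) : ℝ≥0∞ :=
  ⨆ a : EuclideanSpace ℝ (Fin p), ⨆ _ : ‖a‖ = 1, psi2Norm P (fun ω => inner ℝ (x ω) a)

/-- `κ₀`, the `ψ₂`-norm of a standard Gaussian random vector in `ℝ^p`. -/
def kappaZero (p : ℕ) : ℝ :=
  (psi2NormVec (stdGaussian (EuclideanSpace ℝ (Fin p))) (fun g => g)).toReal

/-- The cone generated by `A`: all nonnegative multiples of points of `A` (no convexification). -/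
def coneOf {p : ℕ} (A : Set (EuclideanSpace ℝ (Fin p))) : Set (EuclideanSpace ℝ (Fin p)) :=
  {v | ∃ t : ℝ, 0 ≤ t ∧ ∃ a ∈ A, v = t • a}

/-- `Γ_u = E[Xᵀ u uᵀ X]`, the expectation being taken entrywise. -/
def secondMoment {m p : ℕ} {Ω : Type*} [MeasurableSpace Ω] (P : Measure Ω)
    (X : Ω → Matrix (Fin m) (Fin p) ℝ) (u : EuclideanSpace ℝ (Fin m)) :
    Matrix (Fin p) (Fin p) ℝ :=
  Matrix.of fun i j => ∫ ω, ((X ω)ᵀ * Matrix.vecMulVec u u * X ω) i j ∂P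

/-- `A_Γ = {v ∈ S^{p-1} : Γ^{-1/2} v ∈ cone(A)}`. -/
def transformedSet {p : ℕ} (A : Set (EuclideanSpace ℝ (Fin p)))
    (Γ : Matrix (Fin p) (Fin p) ℝ) : Set (EuclideanSpace ℝ (Fin p)) :=
  {v | ‖v‖ = 1 ∧ Matrix.toEuclideanCLM (𝕜 := ℝ) (CFC.sqrt Γ)⁻¹ v ∈ coneOf A}

end

/-! Write `S` for the square root of `Γ` and let its spectrum lie in `[a, b]`. A point of the
transformed set is `t • S x` with `x ∈ A`, and unit norm forces `t ≤ 1/√a`. Since `⟨S x, g⟩ = ⟨x, S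
g⟩`, its width is controlled by the mean of the support function of `A` at `S g`. That mean is at
most `√b` times the width of `A` (`integral_supportFunction_comp_le`): adding independent noise `B
h` with `B² = b - Γ` turns `S g` into a copy of `√b g`, and by Jensen centred noise can only raise
the mean of a convex function. Replacing `t` by `1/√a` needs a nonnegative bound, which costs the
extra `+ 1` in `gaussianWidth_transformedSet_le`. Finally `κ₀ ≥ 1/2` as soon as a unit vector
exists, so `C = 2` works. -/

/-! ### Support functions and Gaussian width -/

section SupportFunction

variable {p : ℕ} {T : Set (EuclideanSpace ℝ (Fin p))}

/-- The support function `x ↦ sup_{v ∈ T} ⟨v, x⟩` of a set. -/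
noncomputable def supportFunction (T : Set (EuclideanSpace ℝ (Fin p))) (x : EuclideanSpace ℝ (Fin p)) : ℝ :=
  ⨆ v : T, inner ℝ (v : EuclideanSpace ℝ (Fin p)) x

theorem gaussianWidth_eq_integral (T : Set (EuclideanSpace ℝ (Fin p))) :
    gaussianWidth T = ∫ g, supportFunction T g ∂(stdGaussian (EuclideanSpace ℝ (Fin p))) :=
  rfl

theorem inner_le_norm_of_mem_sphere (hT : T ⊆ Metric.sphere 0 1)
    {v : EuclideanSpace ℝ (Fin p)} (hv : v ∈ T) (x : EuclideanSpace ℝ (Fin p)) :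
    inner ℝ v x ≤ ‖x‖ := by
  have h1 : ‖v‖ = 1 := by simpa using hT hv
  simpa [h1] using real_inner_le_norm v x

theorem inner_le_supportFunction (hT : T ⊆ Metric.sphere 0 1)
    {v : EuclideanSpace ℝ (Fin p)} (hv : v ∈ T) (x : EuclideanSpace ℝ (Fin p)) :
    inner ℝ v x ≤ supportFunction T x := by
  refine le_ciSup (f := fun v : T => inner ℝ (v : EuclideanSpace ℝ (Fin p)) x) ⟨‖x‖, ?_⟩ ⟨v, hv⟩
  rintro _ ⟨w, rfl⟩
  exact inner_le_norm_of_mem_sphere hT w.2 x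

theorem supportFunction_le (hne : T.Nonempty) {x : EuclideanSpace ℝ (Fin p)} {r : ℝ}
    (h : ∀ v ∈ T, inner ℝ v x ≤ r) : supportFunction T x ≤ r := by
  have := hne.to_subtype
  exact ciSup_le fun v => h v v.2

theorem supportFunction_empty (x : EuclideanSpace ℝ (Fin p)) :
    supportFunction (∅ : Set (EuclideanSpace ℝ (Fin p))) x = 0 :=
  Real.iSup_of_isEmpty _

theorem supportFunction_zero : supportFunction T 0 = 0 := by
  simp [supportFunction]

/-- Supplies measurability and, with the value `0` at the origin, the bound by `‖x‖` behind all
integrability claims. -/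
theorem lipschitzWith_supportFunction (hT : T ⊆ Metric.sphere 0 1) :
    LipschitzWith 1 (supportFunction T) := by
  refine LipschitzWith.of_le_add fun x y => ?_
  rcases T.eq_empty_or_nonempty with rfl | hne
  · simp [supportFunction_empty]
  · refine supportFunction_le hne fun v hv => ?_
    have h1 := inner_le_supportFunction hT hv y
    have h2 := inner_le_norm_of_mem_sphere hT hv (x - y)
    rw [inner_sub_right] at h2
    rw [dist_eq_norm]
    linarith

theorem abs_supportFunction_le (hT : T ⊆ Metric.sphere 0 1) (x : EuclideanSpace ℝ (Fin p)) :
    |supportFunction T x| ≤ ‖x‖ := by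
  simpa [supportFunction_zero] using (lipschitzWith_supportFunction hT).dist_le_mul x 0

theorem supportFunction_smul {c : ℝ} (hc : 0 ≤ c) (x : EuclideanSpace ℝ (Fin p)) :
    supportFunction T (c • x) = c * supportFunction T x := by
  simp [supportFunction, inner_smul_right, Real.mul_iSup_of_nonneg hc]

theorem integrable_supportFunction (hT : T ⊆ Metric.sphere 0 1)
    (μ : Measure (EuclideanSpace ℝ (Fin p))) [IsGaussian μ] :
    Integrable (supportFunction T) μ :=
  (IsGaussian.integrable_id (μ := μ)).norm.mono'
    (lipschitzWith_supportFunction hT).continuous.aestronglyMeasurable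
    (.of_forall (abs_supportFunction_le hT))

theorem gaussianWidth_empty : gaussianWidth (∅ : Set (EuclideanSpace ℝ (Fin p))) = 0 := by
  simp [gaussianWidth_eq_integral, supportFunction_empty]

theorem integral_inner_stdGaussian (v : EuclideanSpace ℝ (Fin p)) :
    ∫ g, inner ℝ v g ∂(stdGaussian (EuclideanSpace ℝ (Fin p))) = 0 :=
  integral_strongDual_stdGaussian (innerSL ℝ v)

theorem memLp_inner_stdGaussian (v : EuclideanSpace ℝ (Fin p)) :
    MemLp (fun g => inner ℝ v g) 2 (stdGaussian (EuclideanSpace ℝ (Fin p))) :=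
  (innerSL ℝ v).comp_memLp' IsGaussian.memLp_two_id

theorem integral_inner_sq_stdGaussian (v : EuclideanSpace ℝ (Fin p)) :
    ∫ g, inner ℝ v g ^ 2 ∂(stdGaussian (EuclideanSpace ℝ (Fin p))) = ‖v‖ ^ 2 := by
  have h := variance_dual_stdGaussian (innerSL ℝ v)
  rw [variance_of_integral_eq_zero (by fun_prop) (integral_strongDual_stdGaussian _)] at h
  simpa using h

theorem gaussianWidth_nonneg (hT : T ⊆ Metric.sphere 0 1) : 0 ≤ gaussianWidth T := by
  rcases T.eq_empty_or_nonempty with rfl | ⟨v, hv⟩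
  · rw [gaussianWidth_empty]
  · rw [← integral_inner_stdGaussian v, gaussianWidth_eq_integral]
    exact integral_mono ((memLp_inner_stdGaussian v).integrable (by norm_num))
      (integrable_supportFunction hT _) (inner_le_supportFunction hT hv)

end SupportFunction

/-! ### Gaussian comparison by adding independent noise -/

section Contraction

variable {E : Type*} [NormedAddCommGroup E] [InnerProductSpace ℝ E] [FiniteDimensional ℝ E]
  [MeasurableSpace E] [BorelSpace E]

/-- If `S² + B² = c²` for symmetric operators `S`, `B`, then `S g + B h` has the law of `c g` for
independent standard Gaussian vectors `g`, `h`. -/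
theorem map_add_prod_stdGaussian {S B : E →L[ℝ] E} (hS : (S : E →ₗ[ℝ] E).IsSymmetric)
    (hB : (B : E →ₗ[ℝ] E).IsSymmetric) {c : ℝ}
    (h : ∀ t, ‖S t‖ ^ 2 + ‖B t‖ ^ 2 = c ^ 2 * ‖t‖ ^ 2) :
    ((stdGaussian E).prod (stdGaussian E)).map (fun z => S z.1 + B z.2) =
      (stdGaussian E).map (fun g => c • g) := by
  have hmeas : Measurable fun z : E × E => S z.1 + B z.2 := by fun_prop
  have := Measure.isProbabilityMeasure_map
    (μ := (stdGaussian E).prod (stdGaussian E)) hmeas.aemeasurable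
  have := Measure.isProbabilityMeasure_map
    (μ := stdGaussian E) (f := fun g : E => c • g) (by fun_prop)
  apply Measure.ext_of_charFun
  ext t
  -- Independence factors the characteristic function; symmetry moves `S` and `B` onto `t`.
  have key : charFun (((stdGaussian E).prod (stdGaussian E)).map (fun z => S z.1 + B z.2)) t =
      charFun (stdGaussian E) (S t) * charFun (stdGaussian E) (B t) := by
    rw [charFun_apply, charFun_apply, charFun_apply, integral_map (by fun_prop) (by fun_prop),
      ← integral_prod_mul]
    refine integral_congr_ae (.of_forall fun z => ?_)
    have h1 : inner ℝ (S z.1) t = inner ℝ z.1 (S t) := hS z.1 t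
    have h2 : inner ℝ (B z.2) t = inner ℝ z.2 (B t) := hB z.2 t
    simp [inner_add_left, h1, h2, add_mul, Complex.exp_add]
  rw [key, charFun_map_smul, charFun_stdGaussian, charFun_stdGaussian, charFun_stdGaussian,
    ← Complex.exp_add]
  congr 1
  have h' : ((‖S t‖ : ℂ)) ^ 2 + (‖B t‖ : ℂ) ^ 2 = (c : ℂ) ^ 2 * (‖t‖ : ℂ) ^ 2 := by
    exact_mod_cast h t
  have h3 : ((‖c • t‖ : ℝ) : ℂ) ^ 2 = (c : ℂ) ^ 2 * (‖t‖ : ℂ) ^ 2 := by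
    rw [norm_smul, ← Complex.ofReal_pow, mul_pow, Real.norm_eq_abs, sq_abs]
    push_cast
    rfl
  rw [h3, ← h']
  ring

/-- The expected support function of a linear image is at most the operator norm bound times the
Gaussian width. -/
theorem integral_supportFunction_comp_le {p : ℕ} {T : Set (EuclideanSpace ℝ (Fin p))}
    (hT : T ⊆ Metric.sphere 0 1)
    {S B : EuclideanSpace ℝ (Fin p) →L[ℝ] EuclideanSpace ℝ (Fin p)}
    (hS : (S : EuclideanSpace ℝ (Fin p) →ₗ[ℝ] EuclideanSpace ℝ (Fin p)).IsSymmetric)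
    (hB : (B : EuclideanSpace ℝ (Fin p) →ₗ[ℝ] EuclideanSpace ℝ (Fin p)).IsSymmetric)
    {c : ℝ} (hc : 0 ≤ c) (h : ∀ t, ‖S t‖ ^ 2 + ‖B t‖ ^ 2 = c ^ 2 * ‖t‖ ^ 2) :
    ∫ g, supportFunction T (S g) ∂(stdGaussian (EuclideanSpace ℝ (Fin p))) ≤
      c * gaussianWidth T := by
  set γ := stdGaussian (EuclideanSpace ℝ (Fin p))
  have hcont := (lipschitzWith_supportFunction hT).continuous
  have hint (μ : Measure (EuclideanSpace ℝ (Fin p))) [IsGaussian μ]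
      (L : EuclideanSpace ℝ (Fin p) →L[ℝ] EuclideanSpace ℝ (Fin p)) :
      Integrable (fun g => supportFunction T (L g)) μ :=
    (integrable_map_measure hcont.aestronglyMeasurable (by fun_prop)).1
      (integrable_supportFunction hT (μ.map L))
  have hmap := map_add_prod_stdGaussian hS hB h
  have hprod : Integrable (fun z : EuclideanSpace ℝ (Fin p) × EuclideanSpace ℝ (Fin p) =>
      supportFunction T (S z.1 + B z.2)) (γ.prod γ) := by
    refine (integrable_map_measure (f := fun z : EuclideanSpace ℝ (Fin p) ×
      EuclideanSpace ℝ (Fin p) => S z.1 + B z.2) hcont.aestronglyMeasurable (by fun_prop)).1 ?_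
    rw [hmap, integrable_map_measure hcont.aestronglyMeasurable (by fun_prop)]
    exact ((integrable_supportFunction hT γ).const_mul c).congr
      (.of_forall fun g => (supportFunction_smul hc g).symm)
  have hwidth : c * gaussianWidth T =
      ∫ x, ∫ y, supportFunction T (S x + B y) ∂γ ∂γ := by
    have h1 : ∫ x, supportFunction T x ∂(γ.map fun g => c • g) = c * gaussianWidth T := by
      rw [integral_map (by fun_prop) hcont.aestronglyMeasurable]
      simp_rw [supportFunction_smul hc]
      rw [integral_const_mul, gaussianWidth_eq_integral]
    have h2 := integral_map (μ := γ.prod γ) (φ := fun z : EuclideanSpace ℝ (Fin p) ×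
      EuclideanSpace ℝ (Fin p) => S z.1 + B z.2) (by fun_prop)
      (hcont.aestronglyMeasurable (μ := (γ.prod γ).map fun z => S z.1 + B z.2))
    exact (h1.symm.trans (congrArg (fun μ => ∫ x, supportFunction T x ∂μ) hmap.symm)).trans
      (h2.trans (integral_prod _ hprod))
  rw [hwidth]
  rcases T.eq_empty_or_nonempty with rfl | hne
  · simp [supportFunction_empty]
  -- Jensen in the second variable: for fixed `x` and each `v ∈ T`, the term `⟨v, B y⟩` averages to
  -- zero.
  refine integral_mono_ae (hint γ S) hprod.integral_prod_left ?_
  filter_upwards [hprod.prod_right_ae] with x hx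
  refine supportFunction_le hne fun v hv => ?_
  have hv2 : Integrable (fun y => inner ℝ v (B y)) γ :=
    ((innerSL ℝ v).comp B).integrable_comp IsGaussian.integrable_id
  have hv0 : ∫ y, inner ℝ v (B y) ∂γ = 0 :=
    integral_strongDual_stdGaussian ((innerSL ℝ v).comp B)
  calc inner ℝ v (S x) = ∫ y, inner ℝ v (S x) + inner ℝ v (B y) ∂γ := by
        rw [integral_add (integrable_const _) hv2, hv0]; simp
    _ ≤ ∫ y, supportFunction T (S x + B y) ∂γ := by
        refine integral_mono ((integrable_const _).add hv2) hx fun y => ?_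
        have := inner_le_supportFunction hT hv (S x + B y)
        rwa [inner_add_right] at this

end Contraction

/-! ### Spectral bounds and the width of the transformed set -/

section Matrices

variable {p : ℕ} {Γ : Matrix (Fin p) (Fin p) ℝ} {a b : ℝ}

theorem isHermitian_secondMoment {m : ℕ} {Ω : Type*} [MeasurableSpace Ω] (P : Measure Ω)
    (X : Ω → Matrix (Fin m) (Fin p) ℝ) (u : EuclideanSpace ℝ (Fin m)) :
    (secondMoment P X u).IsHermitian := by
  ext i j
  simp only [Matrix.conjTranspose_apply, star_trivial, secondMoment, Matrix.of_apply]
  refine integral_congr_ae (.of_forall fun ω => ?_)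
  have : ((X ω)ᵀ * Matrix.vecMulVec u u * X ω)ᵀ = (X ω)ᵀ * Matrix.vecMulVec u u * X ω := by
    rw [Matrix.transpose_mul, Matrix.transpose_mul, Matrix.transpose_transpose,
      Matrix.transpose_vecMulVec, Matrix.mul_assoc]
  exact congrFun (congrFun this i) j

theorem inner_toEuclideanCLM_bounds (hΓ : Γ.IsHermitian) (hs : spectrum ℝ Γ ⊆ Set.Icc a b)
    (x : EuclideanSpace ℝ (Fin p)) :
    a * ‖x‖ ^ 2 ≤ inner ℝ x (Matrix.toEuclideanCLM (𝕜 := ℝ) Γ x) ∧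
      inner ℝ x (Matrix.toEuclideanCLM (𝕜 := ℝ) Γ x) ≤ b * ‖x‖ ^ 2 := by
  have hsa : IsSelfAdjoint Γ := hΓ
  have h1 := Matrix.le_iff.1 (algebraMap_le_of_le_spectrum (a := Γ) fun y hy => (hs hy).1)
  have h2 := Matrix.le_iff.1 (le_algebraMap_of_spectrum_le (a := Γ) fun y hy => (hs hy).2)
  have hx : x.ofLp ⬝ᵥ x.ofLp = ‖x‖ ^ 2 := by
    rw [EuclideanSpace.real_norm_sq_eq]
    simp [dotProduct, sq]
  have e1 := h1.dotProduct_mulVec_nonneg x.ofLp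
  have e2 := h2.dotProduct_mulVec_nonneg x.ofLp
  simp only [star_trivial, Matrix.sub_mulVec, dotProduct_sub, Algebra.algebraMap_eq_smul_one,
    Matrix.smul_mulVec, Matrix.one_mulVec, dotProduct_smul, hx, smul_eq_mul] at e1 e2
  rw [Matrix.inner_toEuclideanCLM]
  constructor <;> linarith

theorem isSymmetric_toEuclideanCLM (hΓ : Γ.IsHermitian) :
    (Matrix.toEuclideanCLM (𝕜 := ℝ) Γ :
      EuclideanSpace ℝ (Fin p) →ₗ[ℝ] EuclideanSpace ℝ (Fin p)).IsSymmetric := by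
  have hsa : IsSelfAdjoint Γ := hΓ
  exact (hsa.map (Matrix.toEuclideanCLM (n := Fin p) (𝕜 := ℝ))).isSymmetric

theorem norm_sq_toEuclideanCLM_sqrt (hΓ : 0 ≤ Γ) (x : EuclideanSpace ℝ (Fin p)) :
    ‖Matrix.toEuclideanCLM (𝕜 := ℝ) (CFC.sqrt Γ) x‖ ^ 2 =
      inner ℝ x (Matrix.toEuclideanCLM (𝕜 := ℝ) Γ x) := by
  have hsym := isSymmetric_toEuclideanCLM
    (Matrix.nonneg_iff_posSemidef.1 (CFC.sqrt_nonneg Γ)).isHermitian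
  have h := hsym x (Matrix.toEuclideanCLM (𝕜 := ℝ) (CFC.sqrt Γ) x)
  rw [← real_inner_self_eq_norm_sq]
  refine h.trans ?_
  change inner ℝ x ((Matrix.toEuclideanCLM (𝕜 := ℝ) (CFC.sqrt Γ) *
    Matrix.toEuclideanCLM (𝕜 := ℝ) (CFC.sqrt Γ)) x) = _
  rw [← map_mul, CFC.sqrt_mul_sqrt_self Γ hΓ]

/-- The Gaussian width of the normalized image of `A` under `Γ^{1/2}`. -/
theorem gaussianWidth_transformedSet_le (hΓ : Γ.IsHermitian) (ha : 0 < a)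
    (hs : spectrum ℝ Γ ⊆ Set.Icc a b) {A : Set (EuclideanSpace ℝ (Fin p))}
    (hA : A ⊆ Metric.sphere 0 1) (hne : (transformedSet A Γ).Nonempty) :
    gaussianWidth (transformedSet A Γ) ≤ √(b / a) * (gaussianWidth A + 1) := by
  obtain ⟨-, -, -, -, a₀, ha₀, -⟩ := id hne
  have hsph : transformedSet A Γ ⊆ Metric.sphere 0 1 := fun v hv => by simpa using hv.1
  have hna₀ : ‖a₀‖ = 1 := by simpa using hA ha₀
  have hbd := inner_toEuclideanCLM_bounds hΓ hs
  have hab : a ≤ b := by simpa [hna₀] using (hbd a₀).1.trans (hbd a₀).2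
  have hb : 0 < b := ha.trans_le hab
  have hsa : IsSelfAdjoint Γ := hΓ
  have hΓ0 : 0 ≤ Γ := by
    have := algebraMap_le_of_le_spectrum (a := Γ) (r := (0 : ℝ)) fun y hy => ha.le.trans (hs hy).1
    simpa using this
  have hB0 : 0 ≤ algebraMap ℝ (Matrix (Fin p) (Fin p) ℝ) b - Γ :=
    sub_nonneg.2 (le_algebraMap_of_spectrum_le (a := Γ) fun y hy => (hs hy).2)
  set S := Matrix.toEuclideanCLM (𝕜 := ℝ) (CFC.sqrt Γ) with hSdef
  set B := Matrix.toEuclideanCLM (𝕜 := ℝ)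
    (CFC.sqrt (algebraMap ℝ (Matrix (Fin p) (Fin p) ℝ) b - Γ))
  have hSsym := isSymmetric_toEuclideanCLM
    (Matrix.nonneg_iff_posSemidef.1 (CFC.sqrt_nonneg Γ)).isHermitian
  have hBsym := isSymmetric_toEuclideanCLM (Matrix.nonneg_iff_posSemidef.1
    (CFC.sqrt_nonneg (algebraMap ℝ (Matrix (Fin p) (Fin p) ℝ) b - Γ))).isHermitian
  have hSn := norm_sq_toEuclideanCLM_sqrt hΓ0
  have hSB : ∀ t, ‖S t‖ ^ 2 + ‖B t‖ ^ 2 = √b ^ 2 * ‖t‖ ^ 2 := fun t => by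
    rw [hSn, norm_sq_toEuclideanCLM_sqrt hB0, map_sub, Real.sq_sqrt hb.le]
    simp [inner_sub_right, Algebra.algebraMap_eq_smul_one, inner_smul_right]
  have hcontr := integral_supportFunction_comp_le hA hSsym hBsym (Real.sqrt_nonneg b) hSB
  have hdet : IsUnit (CFC.sqrt Γ).det := by
    have hu : IsUnit Γ := by
      rw [← spectrum.zero_notMem_iff ℝ]
      exact fun h0 => ha.not_ge (hs h0).1
    rw [← CFC.sqrt_mul_sqrt_self Γ hΓ0, Matrix.isUnit_iff_isUnit_det, Matrix.det_mul] at hu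
    exact isUnit_of_mul_isUnit_left hu
  -- The bound on `t` comes from `t * ‖S x‖ = 1` and `‖S x‖ ^ 2 = ⟨x, Γ x⟩ ≥ a`.
  have hrep : ∀ v ∈ transformedSet A Γ, ∃ t : ℝ, 0 ≤ t ∧ t ≤ (√a)⁻¹ ∧
      ∃ x ∈ A, v = t • S x := by
    rintro v ⟨hv, t, ht, x, hx, hvx⟩
    have hSv : v = t • S x := by
      rw [← map_smul, ← hvx, ← mul_apply_eq_comp, hSdef, ← map_mul,
        Matrix.mul_nonsing_inv _ hdet]
      simp
    refine ⟨t, ht, ?_, x, hx, hSv⟩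
    have hnx : ‖x‖ = 1 := by simpa using hA hx
    have h1 : √a ≤ ‖S x‖ := by
      apply Real.sqrt_le_iff.2 ⟨norm_nonneg _, ?_⟩
      rw [hSn]
      simpa [hnx] using (hbd x).1
    have h2 : t * ‖S x‖ = 1 := by
      rw [← hv, hSv, norm_smul, Real.norm_of_nonneg ht]
    rw [← one_div, le_div_iff₀ (Real.sqrt_pos.2 ha), ← h2]
    gcongr
  set γ := stdGaussian (EuclideanSpace ℝ (Fin p))
  have hcontA := (lipschitzWith_supportFunction hA).continuous
  have hintS : Integrable (fun g => supportFunction A (S g)) γ :=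
    (integrable_map_measure hcontA.aestronglyMeasurable (by fun_prop)).1
      (integrable_supportFunction hA (γ.map S))
  have hsb : 0 < √b := Real.sqrt_pos.2 hb
  have hsq : Integrable (fun g => (2 * √b)⁻¹ * inner ℝ (S a₀) g ^ 2) γ :=
    (memLp_inner_stdGaussian (S a₀)).integrable_sq.const_mul _
  have hquad : Integrable (fun g => √b / 2 + (2 * √b)⁻¹ * inner ℝ (S a₀) g ^ 2) γ :=
    (integrable_const _).add hsq
  -- The support function of `A` may be negative at `S g`, but it is at least `-|⟨S a₀, g⟩|`. Adding
  -- a majorant of `|⟨S a₀, g⟩|` gives a nonnegative quantity, so `t` may be enlarged to `(√a)⁻¹`.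
  have hpoint : ∀ g, supportFunction (transformedSet A Γ) g ≤
      (√a)⁻¹ * (supportFunction A (S g) + (√b / 2 + (2 * √b)⁻¹ * inner ℝ (S a₀) g ^ 2)) := by
    intro g
    -- AM-GM replaces `|z|` by a quadratic, so only the second moment is needed; with weight `√b`
    -- the expected cost is at most `√b`.
    have hmajor : ∀ z : ℝ, |z| ≤ √b / 2 + (2 * √b)⁻¹ * z ^ 2 := fun z => by
      have h : √b / 2 + (2 * √b)⁻¹ * z ^ 2 - |z| = (2 * √b)⁻¹ * (√b - |z|) ^ 2 := by
        rw [sub_sq, sq_abs]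
        field_simp
        ring
      have : 0 ≤ (2 * √b)⁻¹ * (√b - |z|) ^ 2 := by positivity
      linarith
    have hz := hmajor (inner ℝ (S a₀) g)
    have h0 : -|inner ℝ (S a₀) g| ≤ supportFunction A (S g) :=
      (neg_abs_le _).trans ((hSsym a₀ g).trans_le (inner_le_supportFunction hA ha₀ (S g)))
    have hz0 := abs_nonneg (inner ℝ (S a₀) g)
    refine supportFunction_le hne fun v hv => ?_
    obtain ⟨t, ht, hta, x, hx, rfl⟩ := hrep v hv
    have h1 : inner ℝ (S x) g ≤ supportFunction A (S g) :=
      (hSsym x g).trans_le (inner_le_supportFunction hA hx (S g))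
    rw [inner_smul_left]
    calc t * inner ℝ (S x) g
        ≤ t * (supportFunction A (S g) + (√b / 2 + (2 * √b)⁻¹ * inner ℝ (S a₀) g ^ 2)) := by
          apply mul_le_mul_of_nonneg_left _ ht
          linarith
      _ ≤ _ := by
          apply mul_le_mul_of_nonneg_right hta
          linarith
  have hS0 : ‖S a₀‖ ^ 2 ≤ b := by
    rw [hSn]
    simpa [hna₀] using (hbd a₀).2
  rw [gaussianWidth_eq_integral]
  calc ∫ g, supportFunction (transformedSet A Γ) g ∂γ
      ≤ ∫ g, (√a)⁻¹ * (supportFunction A (S g) +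
          (√b / 2 + (2 * √b)⁻¹ * inner ℝ (S a₀) g ^ 2)) ∂γ :=
        integral_mono (integrable_supportFunction hsph γ)
          ((hintS.add hquad).const_mul _) hpoint
    _ = (√a)⁻¹ * (∫ g, supportFunction A (S g) ∂γ + (√b / 2 + (2 * √b)⁻¹ * ‖S a₀‖ ^ 2)) := by
        rw [integral_const_mul, integral_add hintS hquad,
          integral_add (integrable_const _) hsq, integral_const_mul,
          integral_inner_sq_stdGaussian]
        simp
    _ ≤ (√a)⁻¹ * (√b * gaussianWidth A + (√b / 2 + (2 * √b)⁻¹ * b)) := by gcongr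
    _ = √(b / a) * (gaussianWidth A + 1) := by
        have : (2 * √b)⁻¹ * b = √b / 2 := by
          nth_rewrite 2 [← Real.sq_sqrt hb.le]
          field_simp
        rw [this, Real.sqrt_div hb.le]
        ring

end Matrices

/-! ### Finiteness and lower bound for `κ₀` -/

section KappaZero

variable {p : ℕ}

theorem eLpNorm_inner_stdGaussian_two {v : EuclideanSpace ℝ (Fin p)} (hv : ‖v‖ = 1) :
    eLpNorm (fun g => inner ℝ g v) 2 (stdGaussian (EuclideanSpace ℝ (Fin p))) = 1 := by
  simp_rw [real_inner_comm v]
  rw [(memLp_inner_stdGaussian v).eLpNorm_eq_integral_rpow_norm (by norm_num) (by norm_num)]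
  simp [integral_inner_sq_stdGaussian, hv]

/-- The `ψ₂`-norm of a random vector whose squared norm has an exponential moment is finite. -/
theorem psi2NormVec_lt_top {Ω : Type*} [MeasurableSpace Ω] {P : Measure Ω}
    {x : Ω → EuclideanSpace ℝ (Fin p)} {C : ℝ} (hC : 0 < C)
    (hint : Integrable (fun ω => Real.exp (C * ‖x ω‖ ^ 2)) P) : psi2NormVec P x < ∞ := by
  -- The maximum with `1` ensures `K ^ (1 / q) ≤ K` for every `q ≥ 1`.
  set K : ℝ≥0∞ := max 1 (∫⁻ ω, ENNReal.ofReal (Real.exp (C * ‖x ω‖ ^ 2)) ∂P) with hK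
  have hKtop : K < ∞ := max_lt ENNReal.one_lt_top hint.lintegral_lt_top
  have hbound : psi2NormVec P x ≤ ENNReal.ofReal (√(2 * C))⁻¹ * K := by
    refine iSup₂_le fun v hv => iSup₂_le fun q hq => ?_
    have hq0 : 0 < q := by linarith
    have hpt : ∀ ω, ‖inner ℝ (x ω) v‖ₑ ^ q ≤
        ENNReal.ofReal ((√q * (√(2 * C))⁻¹) ^ q) *
          ENNReal.ofReal (Real.exp (C * ‖x ω‖ ^ 2)) := by
      intro ω
      have h1 : |inner ℝ (x ω) v| ≤ ‖x ω‖ := by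
        simpa [hv] using abs_real_inner_le_norm (x ω) v
      rw [← ofReal_norm, ENNReal.ofReal_rpow_of_nonneg (norm_nonneg _) hq0.le,
        ← ENNReal.ofReal_mul (by positivity)]
      apply ENNReal.ofReal_le_ofReal
      -- This is `y ≤ exp y` at `y = 2 * C * ‖x ω‖ ^ 2 / q`, after squaring.
      have h2 : ‖x ω‖ ≤ (√q * (√(2 * C))⁻¹) * Real.exp (C * ‖x ω‖ ^ 2 / q) := by
        have h3 : 2 * C * ‖x ω‖ ^ 2 / q ≤ Real.exp (2 * C * ‖x ω‖ ^ 2 / q) := by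
          linarith [Real.add_one_le_exp (2 * C * ‖x ω‖ ^ 2 / q)]
        refine (sq_le_sq₀ (norm_nonneg _) (by positivity)).1 ?_
        rw [mul_pow, mul_pow, inv_pow, Real.sq_sqrt hq0.le, Real.sq_sqrt (by positivity),
          ← Real.exp_nat_mul]
        calc ‖x ω‖ ^ 2 = q * (2 * C)⁻¹ * (2 * C * ‖x ω‖ ^ 2 / q) := by field_simp
          _ ≤ q * (2 * C)⁻¹ * Real.exp (2 * C * ‖x ω‖ ^ 2 / q) := by gcongr
          _ = _ := by
            congr 2
            push_cast
            ring
      calc ‖inner ℝ (x ω) v‖ ^ q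
          ≤ ((√q * (√(2 * C))⁻¹) * Real.exp (C * ‖x ω‖ ^ 2 / q)) ^ q := by
            gcongr
            exact h1.trans h2
        _ = _ := by
            rw [Real.mul_rpow (by positivity) (by positivity), ← Real.exp_mul]
            congr 2
            field_simp
    have hnorm : eLpNorm (fun ω => inner ℝ (x ω) v) (ENNReal.ofReal q) P ≤
        ENNReal.ofReal (√q * (√(2 * C))⁻¹) * K := by
      rw [eLpNorm_eq_lintegral_rpow_enorm_toReal (by simpa using hq0) ENNReal.ofReal_ne_top,
        ENNReal.toReal_ofReal hq0.le]
      calc (∫⁻ ω, ‖inner ℝ (x ω) v‖ₑ ^ q ∂P) ^ (1 / q)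
          ≤ (∫⁻ ω, ENNReal.ofReal ((√q * (√(2 * C))⁻¹) ^ q) *
              ENNReal.ofReal (Real.exp (C * ‖x ω‖ ^ 2)) ∂P) ^ (1 / q) := by
            gcongr
            exact hpt _
        _ ≤ (ENNReal.ofReal ((√q * (√(2 * C))⁻¹) ^ q) * K) ^ (1 / q) := by
            rw [lintegral_const_mul' _ _ ENNReal.ofReal_ne_top]
            gcongr
            exact le_max_right _ _
        _ = ENNReal.ofReal (√q * (√(2 * C))⁻¹) * K ^ (1 / q) := by
            rw [ENNReal.mul_rpow_of_nonneg _ _ (by positivity),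
              ENNReal.ofReal_rpow_of_nonneg (by positivity) (by positivity),
              ← Real.rpow_mul (by positivity), mul_one_div_cancel hq0.ne', Real.rpow_one]
        _ ≤ _ := by
            gcongr
            calc K ^ (1 / q) ≤ K ^ (1 : ℝ) :=
                  ENNReal.rpow_le_rpow_of_exponent_le (le_max_left _ _) ((div_le_one hq0).2 hq)
              _ = K := ENNReal.rpow_one K
    apply ENNReal.div_le_of_le_mul
    rwa [mul_right_comm, ← ENNReal.ofReal_mul (by positivity), mul_comm _ √q]
  exact hbound.trans_lt (ENNReal.mul_lt_top ENNReal.ofReal_lt_top hKtop)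

/-- In positive dimension `κ₀` is at least `1 / √2`. -/
theorem one_le_two_mul_kappaZero {v : EuclideanSpace ℝ (Fin p)} (hv : ‖v‖ = 1) :
    1 ≤ 2 * kappaZero p := by
  obtain ⟨C, hC, hint⟩ :=
    IsGaussian.exists_integrable_exp_sq (stdGaussian (EuclideanSpace ℝ (Fin p)))
  -- Finiteness matters: `toReal` would send an infinite norm to `0`.
  have htop := psi2NormVec_lt_top hC hint
  have h : ENNReal.ofReal (√2)⁻¹ ≤
      psi2NormVec (stdGaussian (EuclideanSpace ℝ (Fin p))) (fun g => g) := by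
    -- The exponent `q = 2` alone gives `1 / √2`.
    refine le_trans ?_ (le_iSup₂_of_le v hv (le_iSup₂_of_le 2 one_le_two le_rfl))
    rw [ENNReal.ofReal_ofNat, eLpNorm_inner_stdGaussian_two hv, one_div,
      ENNReal.ofReal_inv_of_pos (by positivity)]
  have h2 : (√2)⁻¹ ≤ kappaZero p := (ENNReal.ofReal_le_iff_le_toReal htop.ne).1 h
  have h3 : 1 / 2 ≤ (√2)⁻¹ := by
    rw [one_div]
    gcongr
    exact Real.sqrt_le_iff.2 (by norm_num)
  linarith

end KappaZero

/-! ### The main theorem -/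

theorem mainTheorem10 :
    ∃ C : ℝ, 0 < C ∧
      ∀ (m p : ℕ) {Ω : Type*} [MeasurableSpace Ω] (P : Measure Ω) [IsProbabilityMeasure P]
        (X : Ω → Matrix (Fin m) (Fin p) ℝ) (μmin μmax : ℝ),
        (∀ i j, MemLp (fun ω => X ω i j) 2 P) →
        0 < μmin →
        (∀ u : EuclideanSpace ℝ (Fin m), ‖u‖ = 1 →
          spectrum ℝ (secondMoment P X u) ⊆ Set.Icc μmin μmax) →
        ∀ u : EuclideanSpace ℝ (Fin m), ‖u‖ = 1 →
        ∀ A : Set (EuclideanSpace ℝ (Fin p)), A ⊆ Metric.sphere 0 1 →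
          gaussianWidth (transformedSet A (secondMoment P X u))
            ≤ C * kappaZero p * √(μmax / μmin) * (gaussianWidth A + 3) := by
  refine ⟨2, two_pos, fun m p Ω _ P _ X μmin μmax _ hmin hspec u hu A hA => ?_⟩
  have hw := gaussianWidth_nonneg hA
  have hκ : 0 ≤ kappaZero p := ENNReal.toReal_nonneg
  -- The empty case covers `p = 0`, where `κ₀ = 0`; otherwise a point of the set is the unit vector
  -- needed to bound `κ₀` below.
  rcases (transformedSet A (secondMoment P X u)).eq_empty_or_nonempty with hE | hne
  · rw [hE, gaussianWidth_empty]
    positivity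
  · obtain ⟨v, hv⟩ := id hne
    calc gaussianWidth (transformedSet A (secondMoment P X u))
        ≤ √(μmax / μmin) * (gaussianWidth A + 1) :=
          gaussianWidth_transformedSet_le (isHermitian_secondMoment P X u) hmin (hspec u hu) hA hne
      _ ≤ 1 * √(μmax / μmin) * (gaussianWidth A + 3) := by
          rw [one_mul]
          gcongr
          norm_num
      _ ≤ 2 * kappaZero p * √(μmax / μmin) * (gaussianWidth A + 3) := by
          gcongr
          exact one_le_two_mul_kappaZero hv.1
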